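/- **Setting.** A schema $\mathbf S$ is a finite set of relation symbols with arities $\ge 0$. An $\mathbf S$-instance is a set of facts $R(a_1,\dots,a_n)$; its active domain $\mathrm{adom}(I)$ is the set of values occurring in its facts. Homomorphisms $I\to J$ are functions $\mathrm{adom}(I)\to\mathrm{adom}(J)$ mapping facts to facts. A $k$-ary pointed instance $(A,\mathbf a)$ is a finite instance with a $k$-tuple $\mathbf a$ of elements of $\mathrm{adom}(A)$. It is *c-acyclic* if every cycle of its incidence multigraph (elements versus facts, one edge per occurrence of an element in a fact) passes through an element of $\mathbf a$. A $k$-ary CQ is a finite conjunction of atoms, existentially quantified except for $k$ answer variables, each of which occurs in some atom; a UCQ is a finite disjunction of $k$-ary CQs; $q(I)$ is its set of answers in $I$. A UCQ is c-acyclic if the canonical instance of each of its CQs (the atoms as facts, pointed by the answer variables) is c-acyclic. Let $\Sigma$ be a set of TGDs $\forall\mathbf x(\phi(\mathbf x)\to\exists\mathbf y\,\psi(\mathbf x,\mathbf y))$ over $\mathbf S$, with $\phi,\psi$ conjunctions of atoms. $P_\Sigma$ is the existential Datalog program with an input, an auxiliary and an output copy of $\mathbf S$ whose rules are the TGDs of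 $\Sigma$ over the auxiliary copy and the copy rules $R(\mathbf x)\leftarrow R_{in}(\mathbf x)$ and $R_{out}(\mathbf x)\leftarrow R(\mathbf x)$ for $R\in\mathbf S$. For a finite or infinite instance $I$, $P_\Sigma(I)$ is the output reduct of a universal solution for $I$, that is, of an instance that contains $I$ (as input facts), satisfies all rules, and has a homomorphism fixing $\mathrm{adom}(I)$ to every other such instance; $P_\Sigma(I)$ may be infinite and is unique up to homomorphisms in both directions that fix $\mathrm{adom}(I)$. $\Sigma$ *has a generalized right-adjoint* if there is a function $\Omega$ that maps every finite instance $J$ to a finite set of pairs $(J',\iota)$, with $J'$ a finite instance and $\iota:\mathrm{adom}(J')\rightharpoonup\mathrm{adom}(J)$ a partial function, such that for all finite or infinite instances $I$: for every homomorphism $h:P_\Sigma(I)\to J$ there are $(J',\iota)\in\Omega(J)$ and a homomorphism $h':I\to J'$, and conversely for every $(J',\iota)\in\Omega(J)$ and every homomorphism $h':I\to J'$ there is a homomorphism $h:P_\Sigma(I)\to J$, such that $\iota(h'(a))=h(a)$ for all $a\in\mathrm{adom}(I)$. UCQs $q,q'$ of the same arity are *equivalent w.r.t. $\Sigma$* if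 $q(I)=q'(I)$ for all finite instances $I\models\Sigma$. $\Sigma$ is *finitely controllable* if, for all UCQs $q,q'$, this holds if and only if $q(I)=q'(I)$ for all finite and infinite instances $I\models\Sigma$. A collection of labeled ABox-examples is a pair $(E^+,E^-)$ of finite sets of $k$-ary pointed instances. A $k$-ary UCQ $q$ *fits* it w.r.t. $\Sigma$ if $\mathbf a\in q(P_\Sigma(A))$ for all $(A,\mathbf a)\in E^+$ and $\mathbf a\notin q(P_\Sigma(A))$ for all $(A,\mathbf a)\in E^-$. **Theorem.** Let $\mathbf S$ be a schema and $\Sigma$ a finite set of TGDs over $\mathbf S$ that has a generalized right-adjoint and is finitely controllable. Then for every $k\ge 0$ and every c-acyclic $k$-ary UCQ $q$ over $\mathbf S$ there is a finite collection of labeled ABox-examples $(E^+,E^-)$ that uniquely characterizes $q$ w.r.t. $\Sigma$: $q$ fits $(E^+,E^-)$ w.r.t. $\Sigma$, and every $k$-ary UCQ that fits $(E^+,E^-)$ w.r.t. $\Sigma$ is equivalent to $q$ w.r.t. $\Sigma$ (over the finite instances satisfying $\Sigma$, and equally over all finite and infinite ones). -/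

import Mathlib

/-! ### Schemas, facts, instances, homomorphisms -/

/-- A schema: finitely many relation symbols, each with an arity (possibly zero). -/
structure Schema where
  Rel : Type
  arity : Rel → ℕ
  finite_rel : Finite Rel

/-- A fact `R(v₁, …, vₙ)` over the schema `S` with values (or variables) in `V`. -/
structure DBFact (S : Schema) (V : Type) where
  rel : S.Rel
  args : Fin (S.arity rel) → V

/-- A possibly infinite `S`-instance with values in `V`: a set of facts. -/
abbrev DBInst (S : Schema) (V : Type) : Type := Set (DBFact S V)

/-- The active domain: the values that occur in the facts. -/
def DBInst.adom {S : Schema} {V : Type} (I : DBInst S V) : Set V :=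
  {v | ∃ f ∈ I, ∃ i, f.args i = v}

theorem DBInst.args_mem_adom {S : Schema} {V : Type} {I : DBInst S V} {f : DBFact S V}
    (hf : f ∈ I) (i : Fin (S.arity f.rel)) : f.args i ∈ I.adom :=
  ⟨f, hf, i, rfl⟩

/-- The image of a fact of `I` under a function defined on the active domain of `I`. -/
def DBFact.image {S : Schema} {V W : Type} {I : DBInst S V} (h : I.adom → W)
    (f : DBFact S V) (hf : f ∈ I) : DBFact S W :=
  ⟨f.rel, fun i => h ⟨f.args i, DBInst.args_mem_adom hf i⟩⟩

/-- Homomorphisms: functions `adom I → adom J` that map facts of `I` to facts of `J`.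
If `I` is a set of atoms whose values are variables, then these are exactly the assignments
(of the variables occurring in `I`) under which the conjunction of the atoms holds in `J`. -/
structure DBHom {S : Schema} {V W : Type} (I : DBInst S V) (J : DBInst S W) where
  toFun : I.adom → J.adom
  map_fact : ∀ f (hf : f ∈ I), DBFact.image (fun v => (toFun v : W)) f hf ∈ J

/-- A finite instance, bundled with its type of values. -/
structure FinInst (S : Schema) where
  Dom : Type
  facts : DBInst S Dom
  finite : facts.Finite

/-- A finite pointed instance with `k` distinguished elements, all from the active domain. -/
structure PointedFinInst (S : Schema) (k : ℕ) extends FinInst S where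
  point : Fin k → facts.adom

/-! ### Incidence graph and c-acyclicity -/

/-- A cycle of length `2 (n + 1)` in the incidence multigraph of `I` (elements versus facts, one
edge for each occurrence of an element in a fact). It runs through pairwise distinct elements
`elem 0, …, elem n` and pairwise distinct facts `fact 0, …, fact n`; it enters `fact j` from
`elem j` through position `inPos j` and leaves it to `elem (j + 1)` (indices modulo `n + 1`) through
position `outPos j ≠ inPos j`. For `n = 0` it is an element with two occurrences in one fact. -/
structure IncidenceCycle {S : Schema} {V : Type} (I : DBInst S V) where
  n : ℕ
  elem : Fin (n + 1) → V
  fact : Fin (n + 1) → DBFact S V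
  elem_injective : Function.Injective elem
  fact_injective : Function.Injective fact
  fact_mem : ∀ j, fact j ∈ I
  inPos : ∀ j, Fin (S.arity (fact j).rel)
  outPos : ∀ j, Fin (S.arity (fact j).rel)
  inPos_ne_outPos : ∀ j, inPos j ≠ outPos j
  args_inPos : ∀ j, (fact j).args (inPos j) = elem j
  args_outPos : ∀ j, (fact j).args (outPos j) = elem (j + 1)

/-- `(I, a)` is c-acyclic: every cycle of the incidence graph passes through an element of `a`. -/
def CAcyclic {S : Schema} {V : Type} {k : ℕ} (I : DBInst S V) (a : Fin k → I.adom) : Prop :=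
  ∀ C : IncidenceCycle I, ∃ j i, C.elem j = (a i : V)

/-! ### (Unions of) conjunctive queries -/

/-- A `k`-ary conjunctive query, with variables from `ℕ`: a finite set of atoms and a tuple of
answer variables, each of which occurs in some atom; the other variables are existentially
quantified. The pair `(body, free)` is at the same time its canonical instance. -/
structure CQ (S : Schema) (k : ℕ) where
  body : DBInst S ℕ
  body_finite : body.Finite
  free : Fin k → body.adom

/-- A `k`-ary union of conjunctive queries: a finite disjunction of `k`-ary CQs. -/
abbrev UCQ (S : Schema) (k : ℕ) : Type := List (CQ S k)

/-- `q(I)` for a CQ `q`. -/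
def CQ.answers {S : Schema} {k : ℕ} {V : Type} (q : CQ S k) (I : DBInst S V) :
    Set (Fin k → V) :=
  {a | ∃ ν : DBHom q.body I, ∀ i, (ν.toFun (q.free i) : V) = a i}

/-- `q(I)` for a UCQ `q`. -/
def UCQ.answers {S : Schema} {k : ℕ} {V : Type} (q : UCQ S k) (I : DBInst S V) :
    Set (Fin k → V) :=
  {a | ∃ c ∈ q, a ∈ CQ.answers c I}

/-- A UCQ is c-acyclic if the canonical instance of each of its CQs is. -/
def UCQ.IsCAcyclic {S : Schema} {k : ℕ} (q : UCQ S k) : Prop :=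
  ∀ c ∈ q, CAcyclic c.body c.free

/-! ### Tuple-generating dependencies -/

/-- A TGD `∀ x (φ(x) → ∃ y ψ(x, y))`, with variables from `ℕ`: `body` is the set of conjuncts of
`φ` and `head` that of `ψ`. The variables `x` are those that occur in the body, the variables `y`
those that occur in the head only. An existential Datalog rule `head :- body` has the same form. -/
structure TGD (S : Schema) where
  body : DBInst S ℕ
  body_finite : body.Finite
  head : DBInst S ℕ
  head_finite : head.Finite

/-- Satisfaction of a TGD: every assignment that makes the body true agrees, on the variables
that the body and the head share, with an assignment that makes the head true. -/
def TGD.Holds {S : Schema} {V : Type} (r : TGD S) (I : DBInst S V) : Prop :=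
  ∀ ν : DBHom r.body I, ∃ μ : DBHom r.head I,
    ∀ (x : ℕ) (hb : x ∈ r.body.adom) (hh : x ∈ r.head.adom),
      (μ.toFun ⟨x, hh⟩ : V) = ν.toFun ⟨x, hb⟩

/-- `I ⊨ Σ`. -/
def Satisfies {S : Schema} {V : Type} (I : DBInst S V) (T : Set (TGD S)) : Prop :=
  ∀ r ∈ T, r.Holds I

/-- Equivalence of UCQs over all finite instances that satisfy `Σ`. -/
def UCQ.FinEquivWrt {S : Schema} {k : ℕ} (T : Set (TGD S)) (q q' : UCQ S k) : Prop :=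
  ∀ (V : Type) (I : DBInst S V), I.Finite → Satisfies I T → UCQ.answers q I = UCQ.answers q' I

/-- Equivalence of UCQs over all finite and infinite instances that satisfy `Σ`. -/
def UCQ.EquivWrt {S : Schema} {k : ℕ} (T : Set (TGD S)) (q q' : UCQ S k) : Prop :=
  ∀ (V : Type) (I : DBInst S V), Satisfies I T → UCQ.answers q I = UCQ.answers q' I

/-- Finite controllability (for UCQs): equivalence over the finite instances satisfying `Σ`
coincides with equivalence over all instances satisfying `Σ`. -/
def FinitelyControllable {S : Schema} (T : Set (TGD S)) : Prop :=
  ∀ (k : ℕ) (q q' : UCQ S k), UCQ.FinEquivWrt T q q' ↔ UCQ.EquivWrt T q q'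

/-! ### Existential Datalog programs and their semantics -/

/-- The disjoint union of two schemas. -/
def Schema.sum (S S' : Schema) : Schema where
  Rel := S.Rel ⊕ S'.Rel
  arity := Sum.elim S.arity S'.arity
  finite_rel := by
    have := S.finite_rel
    have := S'.finite_rel
    infer_instance

/-- A fact over the first summand, as a fact over the disjoint union. -/
def DBFact.inl {S S' : Schema} {V : Type} (f : DBFact S V) : DBFact (S.sum S') V :=
  ⟨Sum.inl f.rel, f.args⟩

/-- A fact over the second summand, as a fact over the disjoint union. -/
def DBFact.inr {S S' : Schema} {V : Type} (f : DBFact S' V) : DBFact (S.sum S') V :=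
  ⟨Sum.inr f.rel, f.args⟩

/-- An existential Datalog program. Its input, auxiliary and output schemas are made disjoint as
the summands of `Sin + (Saux + Sout)`; rule bodies use no output relations and rule heads use no
input relations. -/
structure EDatalog (Sin Saux Sout : Schema) where
  rules : Set (TGD (Sin.sum (Saux.sum Sout)))
  body_rel : ∀ r ∈ rules, ∀ f ∈ r.body, ∀ R : Sout.Rel, f.rel ≠ Sum.inr (Sum.inr R)
  head_rel : ∀ r ∈ rules, ∀ f ∈ r.head, ∀ R : Sin.Rel, f.rel ≠ Sum.inl R

/-- The fact `R(h(v₁), …, h(vₙ))`. -/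
def DBFact.map {S : Schema} {V W : Type} (h : V → W) (f : DBFact S V) : DBFact S W :=
  ⟨f.rel, fun i => h (f.args i)⟩

/-- `J` is a solution for the `Sin`-instance `I`, where the values of `I` are regarded as values
of `J` by means of the injection `e`: `J` contains `I` and satisfies all rules. -/
def EDatalog.IsSolution {Sin Saux Sout : Schema} (P : EDatalog Sin Saux Sout) {V W : Type}
    (I : DBInst Sin V) (e : V ↪ W) (J : DBInst (Sin.sum (Saux.sum Sout)) W) : Prop :=
  (∀ f ∈ I, (f.map e).inl ∈ J) ∧ Satisfies J P.rules

/-- `J` is a universal solution for `I`: it is a solution, and it has a homomorphism that is the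
identity on `adom I` to every solution for `I`. -/
def EDatalog.IsUniversalSolution {Sin Saux Sout : Schema} (P : EDatalog Sin Saux Sout)
    {V W : Type} (I : DBInst Sin V) (e : V ↪ W) (J : DBInst (Sin.sum (Saux.sum Sout)) W) :
    Prop :=
  P.IsSolution I e J ∧
    ∀ (W' : Type) (e' : V ↪ W') (J' : DBInst (Sin.sum (Saux.sum Sout)) W'),
      P.IsSolution I e' J' →
        ∃ h : DBHom J J', ∀ a ∈ I.adom, ∀ ha : e a ∈ J.adom, (h.toFun ⟨e a, ha⟩ : W') = e' a

/-- The values of the chase: the values of the input instance, and for every rule `r`, every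
assignment `ν` of the body variables of `r` and every variable `z` a fresh null. -/
inductive ChaseVal (S : Schema) (V : Type) : Type
  | base (v : V) : ChaseVal S V
  | null (r : TGD S) (ν : r.body.adom → ChaseVal S V) (z : ℕ) : ChaseVal S V

/-- The values of the input instance as values of the chase. -/
def ChaseVal.emb (S : Schema) (V : Type) : V ↪ ChaseVal S V :=
  ⟨ChaseVal.base, fun _ _ h => ChaseVal.base.inj h⟩

open Classical in
/-- The value that the chase gives to a variable of the head of `r` when it fires `r` under the
assignment `ν`: that of `ν` for a body variable, and a fresh null for an existential variable. -/
noncomputable def TGD.headVal {S : Schema} {V : Type} (r : TGD S)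
    (ν : r.body.adom → ChaseVal S V) (z : ℕ) : ChaseVal S V :=
  if h : z ∈ r.body.adom then ν ⟨z, h⟩ else ChaseVal.null r ν z

/-- The facts of the chase: those of `I`, and those derived by firing the rules of `P`. -/
inductive EDatalog.ChaseFact {Sin Saux Sout : Schema} (P : EDatalog Sin Saux Sout) {V : Type}
    (I : DBInst Sin V) :
    DBFact (Sin.sum (Saux.sum Sout)) (ChaseVal (Sin.sum (Saux.sum Sout)) V) → Prop
  | base (f : DBFact Sin V) (hf : f ∈ I) : ChaseFact P I (f.map (ChaseVal.emb _ V)).inl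
  | fire (r : TGD (Sin.sum (Saux.sum Sout))) (hr : r ∈ P.rules)
      (ν : r.body.adom → ChaseVal (Sin.sum (Saux.sum Sout)) V)
      (hν : ∀ f (hf : f ∈ r.body), ChaseFact P I (DBFact.image ν f hf))
      (g : DBFact (Sin.sum (Saux.sum Sout)) ℕ) (hg : g ∈ r.head) :
      ChaseFact P I (g.map (r.headVal ν))

/-- The (possibly infinite) result of the chase. -/
def EDatalog.chase {Sin Saux Sout : Schema} (P : EDatalog Sin Saux Sout) {V : Type}
    (I : DBInst Sin V) :
    DBInst (Sin.sum (Saux.sum Sout)) (ChaseVal (Sin.sum (Saux.sum Sout)) V) :=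
  {F | P.ChaseFact I F}

theorem EDatalog.chase_isSolution {Sin Saux Sout : Schema} (P : EDatalog Sin Saux Sout)
    {V : Type} (I : DBInst Sin V) : P.IsSolution I (ChaseVal.emb _ V) (P.chase I) := by
  refine ⟨fun f hf => .base f hf, fun r hr ν => ?_⟩
  have key : ∀ g (hg : g ∈ r.head),
      g.map (r.headVal fun x => (ν.toFun x : ChaseVal _ V)) ∈ P.chase I :=
    fun g hg => .fire r hr _ (fun f hf => ν.map_fact f hf) g hg
  have hmem : ∀ z : r.head.adom,
      r.headVal (fun x => (ν.toFun x : ChaseVal _ V)) z ∈ (P.chase I).adom := by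
    intro z
    obtain ⟨_, g, hg, i, rfl⟩ := z
    exact DBInst.args_mem_adom (key g hg) i
  refine ⟨⟨fun z => ⟨_, hmem z⟩, key⟩, ?_⟩
  intro x hb hh
  simp [TGD.headVal, hb]

open Classical in
/-- The homomorphism from the chase to a given solution (`none` on values that do not occur). -/
noncomputable def ChaseVal.eval {S : Schema} {V W : Type} (e : V → W) (J : DBInst S W) :
    ChaseVal S V → Option W
  | .base v => some (e v)
  | .null r ν z =>
    if h : ∃ μ : DBHom r.head J, ∀ (x : ℕ) (hb : x ∈ r.body.adom) (hh : x ∈ r.head.adom),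
        some (μ.toFun ⟨x, hh⟩ : W) = ChaseVal.eval e J (ν ⟨x, hb⟩) then
      if hz : z ∈ r.head.adom then some (h.choose.toFun ⟨z, hz⟩ : W) else none
    else none

theorem EDatalog.chaseFact_eval {Sin Saux Sout : Schema} (P : EDatalog Sin Saux Sout)
    {V W : Type} (I : DBInst Sin V) (e : V ↪ W) (J : DBInst (Sin.sum (Saux.sum Sout)) W)
    (hJ : P.IsSolution I e J) (F) (hF : P.ChaseFact I F) :
    ∃ w : Fin _ → W, (∀ i, ChaseVal.eval e J (F.args i) = some (w i)) ∧
      (⟨F.rel, w⟩ : DBFact _ W) ∈ J := by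
  induction hF with
  | base f hf => exact ⟨fun i => e (f.args i), fun i => rfl, hJ.1 f hf⟩
  | fire r hr ν hν g hg ih =>
    have hs : ∀ y : r.body.adom, ∃ w, ChaseVal.eval e J (ν y) = some w := by
      rintro ⟨_, f, hf, i, rfl⟩
      obtain ⟨w, hw, -⟩ := ih f hf
      exact ⟨w i, hw i⟩
    choose w hw using hs
    have hm : ∀ f (hf : f ∈ r.body), DBFact.image w f hf ∈ J := by
      intro f hf
      obtain ⟨w', hw', hJ'⟩ := ih f hf
      have : w' = fun i => w ⟨f.args i, DBInst.args_mem_adom hf i⟩ := by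
        funext i
        exact Option.some.inj ((hw' i).symm.trans (hw _))
      rw [this] at hJ'
      exact hJ'
    obtain ⟨μ, hμ⟩ := hJ.2 r hr
      ⟨fun y => ⟨w y, by
        obtain ⟨_, f, hf, i, rfl⟩ := y
        exact DBInst.args_mem_adom (hm f hf) i⟩, hm⟩
    have hex : ∃ μ : DBHom r.head J,
        ∀ (x : ℕ) (hb : x ∈ r.body.adom) (hh : x ∈ r.head.adom),
          some (μ.toFun ⟨x, hh⟩ : W) = ChaseVal.eval e J (ν ⟨x, hb⟩) :=
      ⟨μ, fun x hb hh => by rw [hw, hμ x hb hh]⟩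
    refine ⟨fun i => (hex.choose.toFun ⟨g.args i, DBInst.args_mem_adom hg i⟩ : W), fun i => ?_,
      hex.choose.map_fact g hg⟩
    have hz : g.args i ∈ r.head.adom := DBInst.args_mem_adom hg i
    by_cases hb : g.args i ∈ r.body.adom
    · simp only [DBFact.map, TGD.headVal, hb, dif_pos]
      exact (hex.choose_spec _ hb hz).symm
    · simp only [DBFact.map, TGD.headVal, hb, dif_neg, not_false_eq_true]
      rw [ChaseVal.eval, dif_pos hex, dif_pos hz]

/-- The chase is a universal solution. -/
theorem EDatalog.chase_isUniversalSolution {Sin Saux Sout : Schema}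
    (P : EDatalog Sin Saux Sout) {V : Type} (I : DBInst Sin V) :
    P.IsUniversalSolution I (ChaseVal.emb _ V) (P.chase I) := by
  refine ⟨P.chase_isSolution I, fun W e J hJ => ?_⟩
  have hs : ∀ y : (P.chase I).adom, ∃ w : J.adom, ChaseVal.eval e J y = some (w : W) := by
    rintro ⟨_, F, hF, i, rfl⟩
    obtain ⟨w, hw, hm⟩ := P.chaseFact_eval I e J hJ F hF
    exact ⟨⟨w i, DBInst.args_mem_adom hm i⟩, hw i⟩
  choose h hh using hs
  refine ⟨⟨h, fun F hF => ?_⟩, fun a _ ha => ?_⟩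
  · obtain ⟨w, hw, hm⟩ := P.chaseFact_eval I e J hJ F hF
    have : w = fun i => (h ⟨F.args i, DBInst.args_mem_adom hF i⟩ : W) := by
      funext i
      exact Option.some.inj ((hw i).symm.trans (hh ⟨F.args i, DBInst.args_mem_adom hF i⟩))
    rw [this] at hm
    exact hm
  · exact Option.some.inj ((hh ⟨_, ha⟩).symm.trans rfl)

/-- `P(I)`: the reduct to the output schema of a universal solution for `I` (the chase). -/
def EDatalog.output {Sin Saux Sout : Schema} (P : EDatalog Sin Saux Sout) {V : Type}
    (I : DBInst Sin V) : DBInst Sout (ChaseVal (Sin.sum (Saux.sum Sout)) V) :=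
  {f | f.inr.inr ∈ P.chase I}

/-! ### Generalized right-adjoints -/

/-- `Ω` is a generalized right-adjoint for `P`. It maps every finite output instance `J` to a finite
set of pairs `(J', ι)` of a finite input instance `J'` and a partial function
`ι : adom J' ⇀ adom J`. For all (finite or infinite) `I`, every homomorphism `P(I) → J` is matched
by a homomorphism `I → J'` for some `(J', ι) ∈ Ω J`, and conversely, such that the square formed
with `ι` and the identity on `adom I ∩ adom P(I)` commutes. -/
def EDatalog.IsGeneralizedRightAdjoint {Sin Saux Sout : Schema} (P : EDatalog Sin Saux Sout)
    (Ω : (J : FinInst Sout) → Set ((J' : FinInst Sin) × (J'.facts.adom → Option J.facts.adom))) :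
    Prop :=
  ∀ J : FinInst Sout, (Ω J).Finite ∧
    ∀ (V : Type) (I : DBInst Sin V),
      (∀ h : DBHom (P.output I) J.facts, ∃ p ∈ Ω J, ∃ h' : DBHom I p.1.facts,
        ∀ (a : I.adom) (ha : ChaseVal.emb _ V a ∈ (P.output I).adom),
          p.2 (h'.toFun a) = some (h.toFun ⟨_, ha⟩)) ∧
      (∀ p ∈ Ω J, ∀ h' : DBHom I p.1.facts, ∃ h : DBHom (P.output I) J.facts,
        ∀ (a : I.adom) (ha : ChaseVal.emb _ V a ∈ (P.output I).adom),
          p.2 (h'.toFun a) = some (h.toFun ⟨_, ha⟩))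

/-- `P` has a generalized right-adjoint. -/
def EDatalog.HasGeneralizedRightAdjoint {Sin Saux Sout : Schema}
    (P : EDatalog Sin Saux Sout) : Prop :=
  ∃ Ω, P.IsGeneralizedRightAdjoint Ω

/-! ### The program of a set of TGDs -/

/-- The atom `R(x₀, …, xₙ₋₁)` with pairwise distinct variables. -/
def Schema.genericAtom (S : Schema) (R : S.Rel) : DBFact S ℕ := ⟨R, fun i => (i : ℕ)⟩

/-- A TGD over `S`, read over the auxiliary copy of `S` in `S + (S + S)`. -/
def TGD.toAux {S : Schema} (r : TGD S) : TGD (S.sum (S.sum S)) where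
  body := (fun f => f.inl.inr) '' r.body
  body_finite := r.body_finite.image _
  head := (fun f => f.inl.inr) '' r.head
  head_finite := r.head_finite.image _

/-- The copy rule `R(x) :- R_in(x)`. -/
def copyIn (S : Schema) (R : S.Rel) : TGD (S.sum (S.sum S)) where
  body := {(S.genericAtom R).inl}
  body_finite := Set.finite_singleton _
  head := {(S.genericAtom R).inl.inr}
  head_finite := Set.finite_singleton _

/-- The copy rule `R_out(x) :- R(x)`. -/
def copyOut (S : Schema) (R : S.Rel) : TGD (S.sum (S.sum S)) where
  body := {(S.genericAtom R).inl.inr}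
  body_finite := Set.finite_singleton _
  head := {(S.genericAtom R).inr.inr}
  head_finite := Set.finite_singleton _

/-- The existential Datalog program `P_Σ` of a set `Σ` of TGDs. Its input, auxiliary and output
schemas are three copies of `S`. -/
def programOf {S : Schema} (T : Set (TGD S)) : EDatalog S S S where
  rules := TGD.toAux '' T ∪ Set.range (copyIn S) ∪ Set.range (copyOut S)
  body_rel := by
    rintro r ((⟨t, -, rfl⟩ | ⟨R', rfl⟩) | ⟨R', rfl⟩) f hf R h
    · obtain ⟨g, -, rfl⟩ := hf
      exact Sum.inl_ne_inr (Sum.inr.inj h)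
    · obtain rfl := hf
      exact Sum.inl_ne_inr h
    · obtain rfl := hf
      exact Sum.inl_ne_inr (Sum.inr.inj h)
  head_rel := by
    rintro r ((⟨t, -, rfl⟩ | ⟨R', rfl⟩) | ⟨R', rfl⟩) f hf R h
    · obtain ⟨g, -, rfl⟩ := hf
      exact Sum.inr_ne_inl h
    · obtain rfl := hf
      exact Sum.inr_ne_inl h
    · obtain rfl := hf
      exact Sum.inr_ne_inl h

/-! ### Labeled ABox-examples -/

/-- The query `q` holds of the ABox-example `(A, a)`: the tuple `a` belongs to `q(P_Σ(A))`. -/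
def UCQ.HoldsOn {S : Schema} {k : ℕ} (T : Set (TGD S)) (q : UCQ S k)
    (A : PointedFinInst S k) : Prop :=
  (fun i => ChaseVal.emb _ A.Dom (A.point i)) ∈ UCQ.answers q ((programOf T).output A.facts)

/-- `q` fits the collection `(Epos, Eneg)` of labeled ABox-examples with respect to `Σ`. -/
def UCQ.Fits {S : Schema} {k : ℕ} (T : Set (TGD S)) (q : UCQ S k)
    (Epos Eneg : Set (PointedFinInst S k)) : Prop :=
  (∀ A ∈ Epos, UCQ.HoldsOn T q A) ∧ ∀ A ∈ Eneg, ¬ UCQ.HoldsOn T q A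

/-- `(Epos, Eneg)` uniquely characterizes `q` with respect to `Σ`: `q` fits it, and every UCQ that
fits it is equivalent to `q` with respect to `Σ` (over finite instances, and also over all
instances; the two agree for finitely controllable `Σ`). -/
def UniquelyCharacterizes {S : Schema} {k : ℕ} (T : Set (TGD S))
    (Epos Eneg : Set (PointedFinInst S k)) (q : UCQ S k) : Prop :=
  UCQ.Fits T q Epos Eneg ∧
    ∀ q' : UCQ S k, UCQ.Fits T q' Epos Eneg → UCQ.FinEquivWrt T q' q ∧ UCQ.EquivWrt T q' q

/-! The proof combines homomorphism duality with the adjoint. C-acyclicity gives `q` a finite set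
`Δ` of targets such that, in every finite or infinite instance, a tuple from the active domain fails
`q` exactly if the instance maps to some target with the tuple going to its point
(`UCQ.exists_isDual`). The positive examples are the canonical instances of the CQs of `q`. The
negative ones are the instances in `Ω X`, for `X ∈ Δ`, pointed by the tuples that `ι` sends to the
point of `X`.

Let `q'` fit and let `I` satisfy `Σ`. Homomorphisms into `I` extend to the output of the program
(`exists_hom_output`). So a match in `I` of a CQ `c` of `q` extends to `P_Σ(c)`, where `q'` holds,
and `q'` holds in `I`. Conversely, an answer to `q'` in `I` that is no answer to `q` gives `P_Σ(I) →
I → X` with `X ∈ Δ`; the adjoint turns this into `I → J'`, and `q'` holds on a negative example.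

For the duals, let `T` be the body of a CQ and `A` its set of answer variables. A pair `(t, x)` in
an element of the dual instance reads "`x` blames `t`". In `dualInst`, every `x ∉ A` blames some
fact through it, and no fact is blamed by all its elements. A homomorphism from `T` under which
elements of `A` blame all their facts would let one pass from `x` to a fact it blames, then to an
element not blaming that fact, and so on; this closes up to a cycle avoiding `A`. If `T` does not
map to `I`, then a variable `x` with value `v` blames a fact of a smallest obstruction to sending
`x` to `v`. Acyclicity allows partial maps to be glued around a fact (`exists_mapsFacts_insert`), so
the elements of a fact cannot all blame it. -/

theorem DBInst.finite_adom {S : Schema} {V : Type} {I : DBInst S V} (hI : I.Finite) :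
    I.adom.Finite := by
  refine (hI.biUnion fun f _ => Set.finite_range f.args).subset ?_
  rintro _ ⟨f, hf, i, rfl⟩
  exact Set.mem_biUnion hf ⟨i, rfl⟩

/-! ### Cycles from alternating choices of facts and elements -/

/-- The value `x` occurs in the fact `f`. -/
def DBFact.Contains {S : Schema} {V : Type} (f : DBFact S V) (x : V) : Prop :=
  ∃ i, f.args i = x

/-- A choice of a fact `F z` through every element `z` of a finite nonempty set, and of another
element `M (F z)` of that set on `F z`, depending on `F z` only, yields a cycle. -/
theorem exists_incidenceCycle {S : Schema} {V : Type} {K : DBInst S V} (hK : K.adom.Finite)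
    {Z : Set V} (hZ : Z.Nonempty) (F : V → DBFact S V) (M : DBFact S V → V)
    (hF : ∀ z ∈ Z, F z ∈ K) (hz : ∀ z ∈ Z, (F z).Contains z)
    (hM : ∀ z ∈ Z, (F z).Contains (M (F z))) (hMZ : ∀ z ∈ Z, M (F z) ∈ Z)
    (hne : ∀ z ∈ Z, M (F z) ≠ z) :
    ∃ C : IncidenceCycle K, ∀ j, C.elem j ∈ Z := by
  have hfin : Z.Finite := hK.subset fun z h => by
    obtain ⟨i, hi⟩ := hz z h
    exact ⟨F z, hF z h, i, hi⟩
  set N : V → V := fun z => M (F z) with hN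
  obtain ⟨z₀, hz₀⟩ := hZ
  have hit : ∀ n, ∀ z ∈ Z, N^[n] z ∈ Z := by
    intro n
    induction n with
    | zero => exact fun z h => h
    | succ n ih => exact fun z h => ih _ (hMZ z h)
  -- The self-map `z ↦ M (F z)` of a finite set has a periodic point; its orbit, of length the
  -- minimal period `n + 1`, is the cycle.
  obtain ⟨x, hx, hper⟩ : ∃ x ∈ Z, x ∈ Function.periodicPts N := by
    have : ¬ Function.Injective fun n : ℕ => N^[n] z₀ := fun hinj =>
      Set.infinite_range_of_injective hinj
        (hfin.subset (by rintro _ ⟨n, rfl⟩; exact hit n z₀ hz₀))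
    obtain ⟨a, b, hab, hlt⟩ : ∃ a b : ℕ, N^[a] z₀ = N^[b] z₀ ∧ a < b := by
      simp only [Function.Injective, not_forall] at this
      obtain ⟨a, b, hab, hne⟩ := this
      rcases lt_or_gt_of_ne hne with h | h
      · exact ⟨a, b, hab, h⟩
      · exact ⟨b, a, hab.symm, h⟩
    refine ⟨N^[a] z₀, hit a z₀ hz₀, b - a, by omega, ?_⟩
    change N^[b - a] (N^[a] z₀) = N^[a] z₀
    rw [← Function.iterate_add_apply, Nat.sub_add_cancel hlt.le, hab]
  have hpos := Function.minimalPeriod_pos_of_mem_periodicPts hper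
  obtain ⟨n, hn⟩ : ∃ n, Function.minimalPeriod N x = n + 1 := ⟨_, (Nat.sub_add_cancel hpos).symm⟩
  have hinj : ∀ i j : Fin (n + 1), N^[i] x = N^[j] x → i = j := fun i j h =>
    Fin.ext (Function.iterate_injOn_Iio_minimalPeriod (by rw [hn]; exact i.2)
      (by rw [hn]; exact j.2) h)
  have hsucc : ∀ j : Fin (n + 1), N^[(j + 1 : Fin (n + 1))] x = N (N^[j] x) := by
    intro j
    rw [← Function.iterate_succ_apply' N, ← Function.iterate_mod_minimalPeriod_eq (n := _ + 1), hn,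
      Fin.val_add, Fin.val_one']
    simp
  choose inp hinp using hz
  choose outp houtp using hM
  refine ⟨⟨n, fun j => N^[j] x, fun j => F (N^[j] x), fun i j h => hinj i j h, fun i j h => ?_,
    fun j => hF _ (hit j x hx), fun j => inp _ (hit j x hx), fun j => outp _ (hit j x hx),
    fun j h => ?_, fun j => hinp _ _, fun j => ?_⟩, fun j => hit j x hx⟩
  -- Facts do not repeat: `M` of a fact is the next element, so equal facts would have equal
  -- successors on the orbit.
  · have h1 : N^[(i + 1 : Fin (n + 1))] x = N^[(j + 1 : Fin (n + 1))] x := by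
      rw [hsucc, hsucc]
      exact congrArg M h
    exact add_right_cancel (hinj _ _ h1)
  · refine hne _ (hit j x hx) ?_
    rw [← houtp _ (hit j x hx), ← h, hinp]
  · rw [hsucc]
    exact houtp _ _

/-! ### Gluing maps along connected components -/

/-- The graph that joins two elements outside `A` if they occur in a common fact of `L`. -/
def linkGraph {S : Schema} {V : Type} (A : Set V) (L : DBInst S V) : SimpleGraph V where
  Adj x y := x ≠ y ∧ x ∉ A ∧ y ∉ A ∧ ∃ s ∈ L, s.Contains x ∧ s.Contains y
  symm := ⟨fun _ _ h => ⟨h.1.symm, h.2.2.1, h.2.1, h.2.2.2.imp fun _ h => ⟨h.1, h.2.2, h.2.1⟩⟩⟩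
  loopless := ⟨fun _ h => h.1 rfl⟩

theorem linkGraph_reachable {S : Schema} {V : Type} {A : Set V} {L : DBInst S V}
    {s : DBFact S V} (hs : s ∈ L) {x y : V} (hx : x ∉ A) (hy : y ∉ A) (hsx : s.Contains x)
    (hsy : s.Contains y) : (linkGraph A L).Reachable x y := by
  by_cases h : x = y
  · rw [h]
  · exact SimpleGraph.Adj.reachable ⟨h, hx, hy, s, hs, hsx, hsy⟩

theorem notMem_of_linkGraph_reachable {S : Schema} {V : Type} {A : Set V} {L : DBInst S V}
    {x y : V} (h : (linkGraph A L).Reachable x y) (hy : y ∉ A) : x ∉ A := by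
  obtain ⟨p⟩ := h
  cases p with
  | nil => exact hy
  | cons h _ => exact h.2.1

/-- Two different occurrences of elements outside `A` in a fact are not linked by the other
facts, if all cycles pass through `A`. -/
theorem eq_of_linkGraph_reachable {S : Schema} {V : Type} {A : Set V} {K L : DBInst S V}
    (hK : K.Finite) (hac : ∀ C : IncidenceCycle K, ∃ j, C.elem j ∈ A) {t : DBFact S V}
    (ht : t ∈ K) (hL : L ⊆ K) (htL : t ∉ L) {i j : Fin (S.arity t.rel)} (hi : t.args i ∉ A)
    (hj : t.args j ∉ A) (h : (linkGraph A L).Reachable (t.args i) (t.args j)) : i = j := by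
  classical
  by_contra hij
  have hfin := DBInst.finite_adom hK
  by_cases hx : t.args i = t.args j
  -- One element at two positions of `t` is already a cycle with `n = 0`.
  · obtain ⟨l, hl⟩ := hac ⟨0, fun _ => t.args i, fun _ => t, fun a b _ => Fin.ext (by omega),
      fun a b _ => Fin.ext (by omega), fun _ => ht, fun _ => i, fun _ => j, fun _ => hij,
      fun _ => rfl, fun _ => hx.symm⟩
    exact hi hl
  set w := t.args j with hw
  set G := linkGraph A L with hG
  have hstep : ∀ z, G.Reachable z w → z ≠ w →
      ∃ s ∈ L, s.Contains z ∧ ∃ z' ∉ A, s.Contains z' ∧ G.dist z' w < G.dist z w := by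
    intro z hz hne
    obtain ⟨p, hp⟩ := hz.exists_walk_length_eq_dist
    obtain ⟨z', ha, p', he⟩ := p.exists_eq_cons_of_ne hne
    suffices hlt : G.dist z' w < G.dist z w by
      obtain ⟨-, -, hz', s, hs, hsz, hsz'⟩ := ha
      exact ⟨s, hs, hsz, z', hz', hsz', hlt⟩
    rw [← hp, he, SimpleGraph.Walk.length_cons]
    exact Nat.lt_succ_of_le (SimpleGraph.dist_le p')
  -- The exit from a fact is its element nearest to `w`. This depends on the fact alone, as the
  -- cycle construction requires.
  have hmin : ∀ s : DBFact S V, ∃ m, (∃ z ∉ A, s.Contains z) →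
      m ∉ A ∧ s.Contains m ∧ ∀ z ∉ A, s.Contains z → G.dist m w ≤ G.dist z w := by
    intro s
    by_cases hs : ∃ z ∉ A, s.Contains z
    · obtain ⟨m, hm, hle⟩ := WellFounded.has_min
        (InvImage.wf (fun z => G.dist z w) Nat.lt_wfRel.wf) {z | z ∉ A ∧ s.Contains z} hs
      exact ⟨m, fun _ => ⟨hm.1, hm.2, fun z hz hsz => not_lt.1 (hle z ⟨hz, hsz⟩)⟩⟩
    · exact ⟨w, fun h => absurd h hs⟩
  have hstep' : ∀ z, ∃ s, G.Reachable z w → z ≠ w →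
      s ∈ L ∧ s.Contains z ∧ ∃ z' ∉ A, s.Contains z' ∧ G.dist z' w < G.dist z w := by
    intro z
    by_cases hz : G.Reachable z w ∧ z ≠ w
    · obtain ⟨s, hs⟩ := hstep z hz.1 hz.2
      exact ⟨s, fun _ _ => hs⟩
    · exact ⟨t, fun h1 h2 => absurd ⟨h1, h2⟩ hz⟩
  choose F hF using hstep'
  choose M hM using hmin
  have key : ∀ z, G.Reachable z w → z ≠ w → M (F z) ∉ A ∧ (F z).Contains (M (F z)) ∧
      G.dist (M (F z)) w < G.dist z w := by
    intro z hz hne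
    obtain ⟨-, hsz, z', hz', hsz', hlt⟩ := hF z hz hne
    obtain ⟨h1, h2, h3⟩ := hM (F z) ⟨z', hz', hsz'⟩
    exact ⟨h1, h2, (h3 z' hz' hsz').trans_lt hlt⟩
  have hFt : ∀ z, G.Reachable z w → z ≠ w → F z ≠ t := fun z hz hne he =>
    htL (he ▸ (hF z hz hne).1)
  -- Elements other than `w` move towards `w` through facts of `L`; at `w` the walk jumps back
  -- through `t` to position `i`.
  obtain ⟨C, hC⟩ := exists_incidenceCycle hfin (Z := {z | G.Reachable z w}) ⟨w, .refl w⟩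
    (fun z => if z = w then t else F z) (fun s => if s = t then t.args i else M s)
    (fun z hz => by
      split_ifs with h
      · exact ht
      · exact hL (hF z hz h).1)
    (fun z hz => by
      split_ifs with h
      · exact ⟨j, h.symm⟩
      · exact (hF z hz h).2.1)
    (fun z hz => by
      by_cases h : z = w
      · simp only [h, if_true]
        exact ⟨i, rfl⟩
      · simp only [h, if_false, hFt z hz h]
        exact (key z hz h).2.1)
    (fun z hz => by
      by_cases h' : z = w
      · simpa only [h', if_true, Set.mem_ofPred_eq] using h
      · simp only [h', if_false, hFt z hz h']
        have hzA := notMem_of_linkGraph_reachable hz hj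
        exact (linkGraph_reachable (hF z hz h').1 (key z hz h').1 hzA (key z hz h').2.1
          (hF z hz h').2.1).trans hz)
    (fun z hz => by
      by_cases h' : z = w
      · simpa only [h', if_true] using hx
      · simp only [h', if_false, hFt z hz h']
        exact fun he => (key z hz h').2.2.ne (by rw [he]))
  obtain ⟨l, hl⟩ := hac C
  exact notMem_of_linkGraph_reachable (hC l) hj hl

/-- The function `h` maps all facts of `L` to facts of `I`, and agrees with `α` on `A`. -/
def MapsFacts {S : Schema} {V W : Type} (A : Set V) (α : V → W) (L : DBInst S V)
    (I : DBInst S W) (h : V → W) : Prop :=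
  Set.EqOn h α A ∧ ∀ f ∈ L, f.map h ∈ I

theorem MapsFacts.mono {S : Schema} {V W : Type} {A : Set V} {α : V → W} {L L' : DBInst S V}
    {I : DBInst S W} {h : V → W} (hh : MapsFacts A α L I h) (hL : L' ⊆ L) :
    MapsFacts A α L' I h :=
  ⟨hh.1, fun f hf => hh.2 f (hL hf)⟩

/-- Maps of `L` that are correct at the different occurrences of elements outside `A` in a fact
`t ∉ L` combine to a single one. -/
theorem exists_mapsFacts_insert {S : Schema} {V W : Type} {A : Set V} {α : V → W}
    {K L : DBInst S V} {I : DBInst S W} (hK : K.Finite)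
    (hac : ∀ C : IncidenceCycle K, ∃ j, C.elem j ∈ A) {t : DBFact S V}
    (ht : t ∈ K) (hL : L ⊆ K) (htL : t ∉ L) {a : Fin (S.arity t.rel) → W}
    (ha : (⟨t.rel, a⟩ : DBFact S W) ∈ I) (haA : ∀ i, t.args i ∈ A → α (t.args i) = a i)
    (hex : ∀ i, t.args i ∉ A → ∃ h, h (t.args i) = a i ∧ MapsFacts A α L I h)
    {h₀ : V → W} (hh₀ : MapsFacts A α L I h₀) :
    ∃ h, (∀ i, h (t.args i) = a i) ∧ MapsFacts A α (insert t L) I h := by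
  classical
  choose g hg using hex
  set G := linkGraph A L with hG
  -- On the component of `t.args i` use the map that is correct at position `i`, on the components
  -- that miss `t` use `h₀`, and on `A` use `α`.
  let h : V → W := fun z =>
    if z ∈ A then α z
    else if hz : ∃ i, ∃ _ : t.args i ∉ A, G.Reachable (t.args i) z then
      g hz.choose hz.choose_spec.choose z
    else h₀ z
  have h_mem : ∀ z ∈ A, h z = α z := fun z hz => if_pos hz
  have h_reach : ∀ i (hi : t.args i ∉ A) z, z ∉ A → G.Reachable (t.args i) z →
      h z = g i hi z := by
    intro i hi z hz hr
    have hex : ∃ i, ∃ _ : t.args i ∉ A, G.Reachable (t.args i) z := ⟨i, hi, hr⟩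
    -- Acyclicity enters here: a component meets `t` in only one position.
    have heq : hex.choose = i :=
      eq_of_linkGraph_reachable hK hac ht hL htL hex.choose_spec.choose hi
        (hex.choose_spec.choose_spec.trans hr.symm)
    simp only [h, if_neg hz, dif_pos hex]
    congr
  have h_not : ∀ z, z ∉ A → (¬ ∃ i, ∃ _ : t.args i ∉ A, G.Reachable (t.args i) z) →
      h z = h₀ z := by
    intro z hz hr
    simp only [h, if_neg hz, dif_neg hr]
  have h_args : ∀ i, h (t.args i) = a i := by
    intro i
    by_cases hi : t.args i ∈ A
    · rw [h_mem _ hi, haA i hi]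
    · rw [h_reach i hi _ hi (.refl _), (hg i hi).1]
  refine ⟨h, h_args, h_mem, ?_⟩
  rintro s (rfl | hs)
  · have : s.map h = ⟨s.rel, a⟩ := by
      simp only [DBFact.map, h_args]
    rwa [this]
  -- The elements of `s` outside `A` lie in a single component, so a single one of the given maps
  -- governs all of `s`.
  by_cases hr : ∃ i, ∃ _ : t.args i ∉ A, ∃ z, z ∉ A ∧ s.Contains z ∧ G.Reachable (t.args i) z
  · obtain ⟨i, hi, z, hz, hsz, hr⟩ := hr
    have : s.map h = s.map (g i hi) := by
      simp only [DBFact.map, DBFact.mk.injEq, heq_eq_eq, true_and]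
      funext l
      by_cases hl : s.args l ∈ A
      · rw [h_mem _ hl, (hg i hi).2.1 hl]
      · exact h_reach i hi _ hl (hr.trans (linkGraph_reachable hs hz hl hsz ⟨l, rfl⟩))
    rw [this]
    exact (hg i hi).2.2 s hs
  · have : s.map h = s.map h₀ := by
      simp only [DBFact.map, DBFact.mk.injEq, heq_eq_eq, true_and]
      funext l
      by_cases hl : s.args l ∈ A
      · rw [h_mem _ hl, hh₀.1 hl]
      · exact h_not _ hl fun ⟨i, hi, hr'⟩ => hr ⟨i, hi, _, hl, ⟨l, rfl⟩, hr'⟩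
    rw [this]
    exact hh₀.2 s hs

/-! ### Dual instances of c-acyclic instances -/

/-- The elements of the dual instances of `T`: sets of pairs of a fact and an element of `T`. -/
abbrev DualElem {S : Schema} {V : Type} (T : DBInst S V) : Type := Set (T × T.adom)

/-- The pair `(t, x)` belongs to the element `X` of the dual instances of `T`. -/
def DualElem.Has {S : Schema} {V : Type} {T : DBInst S V} (X : DualElem T) (t : DBFact S V)
    (x : V) : Prop :=
  ∃ (ht : t ∈ T) (hx : x ∈ T.adom), (⟨t, ht⟩, ⟨x, hx⟩) ∈ X

/-- The dual instance of the set `K` of facts of `T`, with distinguished elements `A`. -/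
def dualInst {S : Schema} {V : Type} (A : Set V) (T K : DBInst S V) : DBInst S (DualElem T) :=
  {F | (∀ i, ∀ x ∈ K.adom, x ∉ A → ∃ t ∈ K, t.Contains x ∧ (F.args i).Has t x) ∧
    ∀ t ∈ K, ∀ h : V → DualElem T, t.map h = F → ∃ x, t.Contains x ∧ ¬ (h x).Has t x}

/-- There is no homomorphism from `K` to its dual instance. -/
theorem exists_incidenceCycle_of_map_dualInst {S : Schema} {V : Type} {A : Set V}
    {T K : DBInst S V} (hK : K.adom.Finite) (hne : K.Nonempty) (g : V → DualElem T)
    (hg : ∀ t ∈ K, t.map g ∈ dualInst A T K)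
    (hA : ∀ y ∈ A, ∀ t ∈ K, t.Contains y → (g y).Has t y) :
    ∃ C : IncidenceCycle K, ∀ j, C.elem j ∉ A := by
  obtain ⟨t₀, ht₀⟩ := hne
  have hM : ∀ t, ∃ x, t ∈ K → t.Contains x ∧ x ∉ A ∧ ¬ (g x).Has t x := by
    intro t
    by_cases ht : t ∈ K
    · obtain ⟨x, hx, hn⟩ := (hg t ht).2 t ht g rfl
      exact ⟨x, fun _ => ⟨hx, fun h => hn (hA x h t ht hx), hn⟩⟩
    · obtain ⟨x, -⟩ := (hg t₀ ht₀).2 t₀ ht₀ g rfl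
      exact ⟨x, fun h => absurd h ht⟩
  have hF : ∀ x, ∃ t, x ∈ K.adom → x ∉ A → t ∈ K ∧ t.Contains x ∧ (g x).Has t x := by
    intro x
    by_cases hx : x ∈ K.adom ∧ x ∉ A
    · obtain ⟨⟨f, hf, i, rfl⟩, hxA⟩ := hx
      obtain ⟨t, ht⟩ := (hg f hf).1 i _ ⟨f, hf, i, rfl⟩ hxA
      exact ⟨t, fun _ _ => ht⟩
    · exact ⟨t₀, fun h h' => absurd ⟨h, h'⟩ hx⟩
  -- `M t` is an element of `t` not blaming `t`, and `F x` a fact blamed by `x`; hence `M (F x) ≠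
  -- x`.
  choose M hM using hM
  choose F hF using hF
  have hmem : ∀ t ∈ K, M t ∈ K.adom := fun t ht => ⟨t, ht, (hM t ht).1⟩
  obtain ⟨C, hC⟩ := exists_incidenceCycle hK (Z := {x | x ∈ K.adom ∧ x ∉ A})
    ⟨M t₀, hmem t₀ ht₀, (hM t₀ ht₀).2.1⟩ F M (fun z hz => (hF z hz.1 hz.2).1)
    (fun z hz => (hF z hz.1 hz.2).2.1) (fun z hz => (hM _ (hF z hz.1 hz.2).1).1)
    (fun z hz => ⟨hmem _ (hF z hz.1 hz.2).1, (hM _ (hF z hz.1 hz.2).1).2.1⟩)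
    (fun z hz h => (hM _ (hF z hz.1 hz.2).1).2.2 (by rw [h]; exact (hF z hz.1 hz.2).2.2))
  exact ⟨C, fun j => (hC j).2⟩

/-- If `T` does not map to `I`, then `I` maps to the dual instance of some subset of `T`. -/
theorem exists_map_dualInst {S : Schema} {V W : Type} [Nonempty W] {A : Set V} {α : V → W}
    {T : DBInst S V} {I : DBInst S W} (hT : T.Finite)
    (hac : ∀ C : IncidenceCycle T, ∃ j, C.elem j ∈ A) (hI : ∀ h, ¬ MapsFacts A α T I h) :
    ∃ K ⊆ T, K.Nonempty ∧ ∃ φ : W → DualElem T, (∀ f ∈ I, f.map φ ∈ dualInst A T K) ∧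
      ∀ y ∈ A, ∀ t ∈ K, t.Contains y → (φ (α y)).Has t y := by
  classical
  -- `K` is a smallest part of `T` that does not map to `I`.
  obtain ⟨K, ⟨hKT, hK⟩, hKmin⟩ := WellFounded.has_min
    (InvImage.wf (fun L : DBInst S V => L.ncard) Nat.lt_wfRel.wf)
    {L | L ⊆ T ∧ ∀ h, ¬ MapsFacts A α L I h} ⟨T, subset_rfl, hI⟩
  have hKfin := hT.subset hKT
  have hKmin' : ∀ L, L ⊂ K → ∃ h, MapsFacts A α L I h := by
    intro L hL
    by_contra! hn
    exact hKmin L ⟨hL.subset.trans hKT, hn⟩ (Set.ncard_lt_ncard hL hKfin)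
  have hKne : K.Nonempty := by
    rw [Set.nonempty_iff_ne_empty]
    rintro rfl
    exact hK α ⟨fun _ _ => rfl, fun _ h => absurd h (Set.notMem_empty _)⟩
  -- `L` is an obstruction of least cardinality to sending `x` to `v`. Comparing cardinalities makes
  -- obstructions for different pairs comparable.
  have hL : ∀ x v, ∃ L ⊆ K, (∀ h, h x = v → ¬ MapsFacts A α L I h) ∧
      ∀ L' ⊆ K, L'.ncard < L.ncard → ∃ h, h x = v ∧ MapsFacts A α L' I h := by
    intro x v
    obtain ⟨L, ⟨h1, h2⟩, hmin⟩ := WellFounded.has_min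
      (InvImage.wf (fun L : DBInst S V => L.ncard) Nat.lt_wfRel.wf)
      {L | L ⊆ K ∧ ∀ h, h x = v → ¬ MapsFacts A α L I h} ⟨K, subset_rfl, fun h _ => hK h⟩
    refine ⟨L, h1, h2, fun L' hL' hlt => ?_⟩
    by_contra! hn
    exact hmin L' ⟨hL', hn⟩ hlt
  choose L hLK hLfail hLmin using hL
  have ht : ∀ x v, ∃ t, x ∈ K.adom → x ∉ A → t ∈ L x v ∧ t.Contains x := by
    intro x v
    by_cases hx : x ∈ K.adom ∧ x ∉ A
    · suffices ∃ t ∈ L x v, t.Contains x from this.imp fun t ht _ _ => ht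
      -- An obstruction without a fact through `x` is a proper part of `K`, so it maps to `I`;
      -- resetting `x` to `v` disturbs none of its facts.
      by_contra! hn
      obtain ⟨⟨f, hf, i, rfl⟩, hxA⟩ := hx
      have hss : L (f.args i) v ⊂ K := (hLK _ _).ssubset_of_mem_notMem hf fun h => hn f h ⟨i, rfl⟩
      obtain ⟨h, hh⟩ := hKmin' _ hss
      refine hLfail (f.args i) v (Function.update h (f.args i) v) (by simp) ⟨fun y hy => ?_,
        fun s hs => ?_⟩
      · rw [Function.update_of_ne (by rintro rfl; exact hxA hy), hh.1 hy]
      · have : s.map (Function.update h (f.args i) v) = s.map h := by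
          simp only [DBFact.map, DBFact.mk.injEq, heq_eq_eq, true_and]
          funext l
          exact Function.update_of_ne (fun he => hn s hs ⟨l, he⟩) _ _
        rw [this]
        exact hh.2 s hs
    · obtain ⟨t, -⟩ := hKne
      exact ⟨t, fun h h' => absurd ⟨h, h'⟩ hx⟩
  choose b hb using ht
  -- With value `v`, a variable outside `A` blames the chosen fact `b x v` of its obstruction; one
  -- in `A` blames every fact if `v` is its prescribed value, and none otherwise.
  let φ : W → DualElem T := fun v =>
    {p | (p.2.1 ∈ A ∧ α p.2.1 = v) ∨ (p.2.1 ∉ A ∧ p.1.1 = b p.2.1 v)}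
  have hTK : ∀ {t x}, t ∈ K → t.Contains x → t ∈ T ∧ x ∈ T.adom := fun ht hx =>
    ⟨hKT ht, _, hKT ht, hx⟩
  refine ⟨K, hKT, hKne, φ, fun f hf => ⟨fun i x hx hxA => ?_, fun t ht h hfh => ?_⟩,
    fun y hy t ht hty => ⟨(hTK ht hty).1, (hTK ht hty).2, Or.inl ⟨hy, rfl⟩⟩⟩
  · obtain ⟨h1, h2⟩ := hb x (f.args i) hx hxA
    have := hTK (hLK _ _ h1) h2
    exact ⟨_, hLK _ _ h1, h2, this.1, this.2, Or.inr ⟨hxA, rfl⟩⟩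
  · by_contra! hn
    obtain ⟨R, a⟩ := f
    obtain ⟨R', x⟩ := t
    obtain rfl : R' = R := congrArg DBFact.rel hfh
    have hfh' : ∀ i, h (x i) = φ (a i) := by
      simp only [DBFact.map, DBFact.mk.injEq, heq_eq_eq, true_and] at hfh
      exact fun i => congrFun hfh i
    have hhas : ∀ i, (x i ∈ A ∧ α (x i) = a i) ∨ (x i ∉ A ∧ ⟨R', x⟩ = b (x i) (a i)) := by
      intro i
      have := hn (x i) ⟨i, rfl⟩
      rw [hfh'] at this
      exact this.choose_spec.choose_spec
    set t : DBFact S V := ⟨R', x⟩ with htdef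
    have hxA : ∀ i, x i ∈ A → α (x i) = a i := fun i hi =>
      (hhas i).elim (fun h => h.2) fun h => absurd hi h.1
    have hadom : ∀ i, x i ∈ K.adom := fun i => ⟨t, ht, i, rfl⟩
    have hxL : ∀ i, x i ∉ A → t ∈ L (x i) (a i) := fun i hi => by
      rw [((hhas i).resolve_left fun h => hi h.1).2]
      exact (hb _ _ (hadom i) hi).1
    have hacK : ∀ C : IncidenceCycle K, ∃ j, C.elem j ∈ A := fun C =>
      hac { C with fact_mem := fun j => hKT (C.fact_mem j) }
    by_cases hall : ∃ i, x i ∉ A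
    -- The fact `t` lies in all obstructions `L (x j) (a j)` with `x j ∉ A`. Without `t`, the
    -- smallest is smaller than each of them, so it allows sending any such `x j` to `a j`. Gluing
    -- these maps over `t` defeats that smallest obstruction.
    · obtain ⟨i, hi, hmin⟩ := WellFounded.has_min
        (InvImage.wf (fun i => (L (x i) (a i)).ncard) Nat.lt_wfRel.wf) {i | x i ∉ A} hall
      have hlt : (L (x i) (a i) \ {t}).ncard < (L (x i) (a i)).ncard :=
        Set.ncard_sdiff_singleton_lt_of_mem (hxL i hi) (hKfin.subset (hLK _ _))
      have hsub : L (x i) (a i) \ {t} ⊆ K := Set.sdiff_subset.trans (hLK _ _)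
      obtain ⟨h₀, -, hh₀⟩ := hLmin _ _ _ hsub hlt
      obtain ⟨h, hh1, hh2⟩ := exists_mapsFacts_insert hKfin hacK ht hsub (by simp) hf hxA
        (fun j hj => hLmin _ _ _ hsub (hlt.trans_le (not_lt.1 (hmin j hj)))) hh₀
      refine hLfail _ _ h (hh1 i) (hh2.mono ?_)
      rw [Set.insert_sdiff_singleton]
      exact Set.subset_insert _ _
    -- With all elements of `t` in `A` there is no obstruction to use; the minimality of `K` takes
    -- its place.
    · push Not at hall
      obtain ⟨h₀, hh₀⟩ := hKmin' (K \ {t}) (Set.sdiff_singleton_ssubset.2 ht)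
      obtain ⟨h, -, hh⟩ := exists_mapsFacts_insert hKfin hacK ht Set.sdiff_subset (by simp) hf hxA
        (fun j hj => absurd (hall j) hj) hh₀
      exact hK h (hh.mono (by simp))

instance {S : Schema} {V : Type} [Finite V] : Finite (DBFact S V) := by
  have := S.finite_rel
  exact Finite.of_injective (β := Σ R : S.Rel, Fin (S.arity R) → V)
    (fun f => ⟨f.rel, f.args⟩) fun ⟨_, _⟩ ⟨_, _⟩ h => by
      simp only [Sigma.mk.injEq] at h
      simpa using h

/-! ### Finite duals of queries -/

/-- A function that maps facts to facts maps the active domain to the active domain. -/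
def DBHom.ofFun {S : Schema} {V W : Type} {I : DBInst S V} {J : DBInst S W} (g : I.adom → W)
    (hg : ∀ f (hf : f ∈ I), DBFact.image g f hf ∈ J) : DBHom I J where
  toFun v := ⟨g v, by
    obtain ⟨_, f, hf, i, rfl⟩ := v
    exact DBInst.args_mem_adom (hg f hf) i⟩
  map_fact := hg

def DBHom.comp {S : Schema} {U V W : Type} {I : DBInst S U} {J : DBInst S V} {K : DBInst S W}
    (h : DBHom J K) (g : DBHom I J) : DBHom I K where
  toFun v := h.toFun (g.toFun v)
  map_fact f hf := h.map_fact _ (g.map_fact f hf)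

def DBHom.id {S : Schema} {V : Type} (I : DBInst S V) : DBHom I I where
  toFun v := v
  map_fact _ hf := hf

/-- A finite instance with `k` distinguished values, which need not occur in its facts. -/
structure DualTarget (S : Schema) (k : ℕ) where
  Dom : Type
  finite_dom : Finite Dom
  facts : DBInst S Dom
  pt : Fin k → Dom

abbrev DualTarget.toFinInst {S : Schema} {k : ℕ} (X : DualTarget S k) : FinInst S where
  Dom := X.Dom
  facts := X.facts
  finite := by
    have := X.finite_dom
    exact Set.toFinite _

/-- There is a homomorphism from `I` to `X` that maps `a` to the distinguished values. -/
def DualTarget.Admits {S : Schema} {k : ℕ} (X : DualTarget S k) {W : Type} {I : DBInst S W}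
    (a : Fin k → I.adom) : Prop :=
  ∃ h : DBHom I X.facts, ∀ i, (h.toFun (a i) : X.Dom) = X.pt i

/-- The targets in `Δ` are dual to the query with answers `Q`: a tuple is no answer if and only
if it maps to some target in `Δ`. -/
def IsDual {S : Schema} {k : ℕ} (Q : ∀ {W : Type}, DBInst S W → Set (Fin k → W))
    (Δ : Set (DualTarget S k)) : Prop :=
  ∀ {W : Type} (I : DBInst S W) (a : Fin k → I.adom),
    (fun i => (a i : W)) ∉ Q I ↔ ∃ X ∈ Δ, X.Admits a

/-- The instance with two values and all facts. -/
def DualTarget.full (S : Schema) {k : ℕ} (d : Fin k → Bool) : DualTarget S k :=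
  ⟨Bool, inferInstance, Set.univ, d⟩

/-- The dual instance of `K`, with distinguished elements `d`. -/
def DualTarget.ofDual {S : Schema} {k : ℕ} {V : Type} {T : DBInst S V} (hT : T.Finite)
    (A : Set V) (K : DBInst S V) (d : Fin k → DualElem T) : DualTarget S k where
  Dom := DualElem T
  finite_dom := by
    have := hT.to_subtype
    have := (DBInst.finite_adom hT).to_subtype
    infer_instance
  facts := dualInst A T K
  pt := d

/-- If all cycles of `T` pass through `a`, then `T` does not map to a dual instance in such a way
that `a` is mapped to suitable elements `d`. -/
theorem not_hom_dualInst {S : Schema} {k : ℕ} {V : Type} {T K : DBInst S V} {a : Fin k → T.adom}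
    (hac : ∀ C : IncidenceCycle T, ∃ j, C.elem j ∈ Set.range fun i => (a i : V)) (hT : T.Finite)
    (hne : K.Nonempty) (hsub : K ⊆ T) (d : Fin k → DualElem T)
    (hd : ∀ i, ∀ t ∈ K, t.Contains (a i) → (d i).Has t (a i))
    (g : DBHom T (dualInst (Set.range fun i => (a i : V)) T K))
    (hg : ∀ i, (g.toFun (a i) : DualElem T) = d i) : False := by
  classical
  let g' : V → DualElem T := fun y => if hy : y ∈ T.adom then g.toFun ⟨y, hy⟩ else ∅
  have hg' : ∀ y : T.adom, g' y = (g.toFun y : DualElem T) := fun y => dif_pos y.2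
  obtain ⟨C, hC⟩ := exists_incidenceCycle_of_map_dualInst
    (DBInst.finite_adom (hT.subset hsub)) hne g'
    (by
      intro t ht
      convert g.map_fact t (hsub ht) using 1
      simp only [DBFact.map, DBFact.image, DBFact.mk.injEq, heq_eq_eq, true_and]
      funext i
      exact hg' ⟨t.args i, DBInst.args_mem_adom (hsub ht) i⟩)
    (by
      rintro _ ⟨i, rfl⟩ t ht hti
      have := hd i t ht hti
      rwa [← hg, ← hg'] at this)
  obtain ⟨j, hj⟩ := hac { C with fact_mem := fun j => hsub (C.fact_mem j) }
  exact hC j hj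

/-- A c-acyclic CQ has a finite set of duals. -/
theorem CQ.exists_isDual {S : Schema} {k : ℕ} (c : CQ S k) (hc : CAcyclic c.body c.free) :
    ∃ Δ : Set (DualTarget S k), Δ.Finite ∧ IsDual c.answers Δ := by
  classical
  set A : Set ℕ := Set.range fun i => (c.free i : ℕ) with hA
  have hac : ∀ C : IncidenceCycle c.body, ∃ j, C.elem j ∈ A := fun C => by
    obtain ⟨j, i, h⟩ := hc C
    exact ⟨j, i, h.symm⟩
  -- These targets catch the tuples that differ at two positions carrying the same answer variable.
  let Δ₁ : Set (DualTarget S k) := DualTarget.full S ''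
    {d | ∃ i j, c.free i = c.free j ∧ d i ≠ d j}
  let Δ₂ : Set (DualTarget S k) :=
    (fun p : Set c.body × (Fin k → DualElem c.body) =>
      DualTarget.ofDual c.body_finite A (Subtype.val '' p.1) p.2) ''
    {p | p.1.Nonempty ∧
      ∀ i, ∀ t ∈ p.1, t.1.Contains (c.free i) → (p.2 i).Has t (c.free i)}
  have := c.body_finite.to_subtype
  have := (DBInst.finite_adom c.body_finite).to_subtype
  refine ⟨Δ₁ ∪ Δ₂, ((Set.toFinite _).image _).union ((Set.toFinite _).image _), ?_⟩
  intro W I a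
  constructor
  · intro hna
    by_cases hfac : ∀ i j, c.free i = c.free j → (a i : W) = a j
    -- Passing to `Option W` provides a default value off the answer variables, even if `W` is
    -- empty. Variables of the body still get values `some w`, since all facts of the lifted
    -- instance consist of such values.
    · let α : ℕ → Option W := fun y =>
        if h : ∃ i, (c.free i : ℕ) = y then some (a h.choose : W) else none
      have hα : ∀ i, α (c.free i) = some (a i : W) := by
        intro i
        have h : ∃ j, (c.free j : ℕ) = c.free i := ⟨i, rfl⟩
        simp only [α, dif_pos h]
        rw [hfac _ _ (Subtype.ext h.choose_spec)]
      obtain ⟨K, hK, hKne, φ, hφ, hφA⟩ := exists_map_dualInst (A := A) (α := α)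
        (I := DBFact.map some '' I) c.body_finite hac fun h ⟨hh1, hh2⟩ => by
          have hsome : ∀ y : c.body.adom, ∃ w : W, h y = some w := by
            rintro ⟨_, f, hf, i, rfl⟩
            obtain ⟨g, -, hgf⟩ := hh2 f hf
            obtain ⟨R, x⟩ := f
            obtain ⟨R', y⟩ := g
            obtain rfl : R' = R := congrArg DBFact.rel hgf
            simp only [DBFact.map, DBFact.mk.injEq, heq_eq_eq, true_and] at hgf
            exact ⟨y i, (congrFun hgf i).symm⟩
          choose w hw using hsome
          refine hna ⟨DBHom.ofFun w fun f hf => ?_, fun i => ?_⟩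
          · obtain ⟨g, hg, hgf⟩ := hh2 f hf
            obtain ⟨R, x⟩ := f
            obtain ⟨R', y⟩ := g
            obtain rfl : R' = R := congrArg DBFact.rel hgf
            simp only [DBFact.map, DBFact.mk.injEq, heq_eq_eq, true_and] at hgf
            convert hg using 1
            simp only [DBFact.image, DBFact.mk.injEq, heq_eq_eq, true_and]
            funext i
            exact Option.some.inj ((hw ⟨x i, DBInst.args_mem_adom hf i⟩).symm.trans
              (congrFun hgf i).symm)
          · have h1 := hh1 ⟨i, rfl⟩
            rw [hα] at h1
            exact Option.some.inj ((hw (c.free i)).symm.trans h1)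
      refine ⟨_, Or.inr ⟨(Subtype.val ⁻¹' K, fun i => φ (some (a i : W))), ⟨?_, ?_⟩, rfl⟩,
        DBHom.ofFun (fun v => φ (some (v : W))) fun f hf => ?_, fun i => rfl⟩
      · obtain ⟨t, ht⟩ := hKne
        exact ⟨⟨t, hK ht⟩, ht⟩
      · intro i t ht hti
        have := hφA _ ⟨i, rfl⟩ t ht hti
        rwa [hα] at this
      · change f.map (fun v => φ (some v)) ∈ dualInst A c.body (Subtype.val '' (Subtype.val ⁻¹' K))
        rw [Subtype.image_preimage_coe, Set.inter_eq_self_of_subset_right hK]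
        exact hφ _ ⟨f, hf, rfl⟩
    · push Not at hfac
      obtain ⟨i, j, hij, hne⟩ := hfac
      refine ⟨_, Or.inl ⟨fun l => decide ((a l : W) = a i), ⟨i, j, hij, ?_⟩, rfl⟩,
        DBHom.ofFun (fun v => decide ((v : W) = a i)) fun f hf => Set.mem_univ _, fun l => rfl⟩
      simp [Ne.symm hne]
  · rintro ⟨X, hX, h, hh⟩ ⟨ν, hν⟩
    have hpt : ∀ i, ((h.comp ν).toFun (c.free i) : X.Dom) = X.pt i := fun i => by
      rw [← hh]
      exact congrArg (fun v => (h.toFun v : X.Dom)) (Subtype.ext (hν i))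
    generalize h.comp ν = g at hpt
    rcases hX with ⟨d, ⟨i, j, hij, hne⟩, rfl⟩ | ⟨⟨K, d⟩, ⟨hKne, hd⟩, rfl⟩
    · exact hne (by rw [← show _ = d i from hpt i, ← show _ = d j from hpt j, hij])
    · exact not_hom_dualInst hac c.body_finite (hKne.image _) (by simp) d
        (fun i t ht => by
          obtain ⟨t, ht, rfl⟩ := ht
          exact hd i t ht) g hpt

/-- The direct product of two targets. -/
def DualTarget.prod {S : Schema} {k : ℕ} (X Y : DualTarget S k) : DualTarget S k where
  Dom := X.Dom × Y.Dom
  finite_dom := by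
    have := X.finite_dom
    have := Y.finite_dom
    infer_instance
  facts := {f | f.map Prod.fst ∈ X.facts ∧ f.map Prod.snd ∈ Y.facts}
  pt i := (X.pt i, Y.pt i)

theorem DualTarget.admits_prod {S : Schema} {k : ℕ} (X Y : DualTarget S k) {W : Type}
    {I : DBInst S W} (a : Fin k → I.adom) :
    (X.prod Y).Admits a ↔ X.Admits a ∧ Y.Admits a := by
  constructor
  · rintro ⟨h, hh⟩
    exact ⟨⟨DBHom.ofFun (fun v => (h.toFun v : (X.prod Y).Dom).1) fun f hf => (h.map_fact f hf).1,
        fun i => congrArg Prod.fst (hh i)⟩,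
      ⟨DBHom.ofFun (fun v => (h.toFun v : (X.prod Y).Dom).2) fun f hf => (h.map_fact f hf).2,
        fun i => congrArg Prod.snd (hh i)⟩⟩
  · rintro ⟨⟨g, hg⟩, h, hh⟩
    exact ⟨DBHom.ofFun (fun v => ((g.toFun v : X.Dom), (h.toFun v : Y.Dom)))
      fun f hf => ⟨g.map_fact f hf, h.map_fact f hf⟩, fun i => Prod.ext (hg i) (hh i)⟩

/-- A c-acyclic UCQ has a finite set of duals. -/
theorem UCQ.exists_isDual {S : Schema} {k : ℕ} (q : UCQ S k) (hq : UCQ.IsCAcyclic q) :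
    ∃ Δ : Set (DualTarget S k), Δ.Finite ∧ IsDual (UCQ.answers q) Δ := by
  induction q with
  | nil =>
    refine ⟨{DualTarget.full S fun _ => true}, Set.finite_singleton _, fun {W} I a => ?_⟩
    refine ⟨fun _ => ⟨_, rfl, DBHom.ofFun (fun _ => true) fun _ _ => Set.mem_univ _,
      fun _ => rfl⟩, ?_⟩
    rintro - ⟨c, hc, -⟩
    exact List.not_mem_nil hc
  | cons c q ih =>
    obtain ⟨Δ₁, hfin₁, hΔ₁⟩ := c.exists_isDual (hq c List.mem_cons_self)
    obtain ⟨Δ₂, hfin₂, hΔ₂⟩ := ih fun c' hc' => hq c' (List.mem_cons_of_mem _ hc')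
    -- A tuple fails a disjunction if it fails both parts, that is, if it maps to a target of each
    -- and hence to their product.
    refine ⟨Set.image2 DualTarget.prod Δ₁ Δ₂, hfin₁.image2 _ hfin₂, fun {W} I a => ?_⟩
    have h : (fun i => (a i : W)) ∉ UCQ.answers (c :: q) I ↔
        (fun i => (a i : W)) ∉ c.answers I ∧ (fun i => (a i : W)) ∉ UCQ.answers q I := by
      simp only [UCQ.answers, Set.mem_ofPred_eq, List.exists_mem_cons_iff, not_or]
    rw [h, hΔ₁, hΔ₂]
    constructor
    · rintro ⟨⟨X, hX, hXa⟩, Y, hY, hYa⟩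
      exact ⟨_, ⟨X, hX, Y, hY, rfl⟩, (X.admits_prod Y a).2 ⟨hXa, hYa⟩⟩
    · rintro ⟨_, ⟨X, hX, Y, hY, rfl⟩, ha⟩
      obtain ⟨hXa, hYa⟩ := (X.admits_prod Y a).1 ha
      exact ⟨⟨X, hX, hXa⟩, Y, hY, hYa⟩

/-! ### Extending homomorphisms to the output of the program -/

/-- The relation between `V ⊕ W` and `W` given by the identity on `W` and a function `g` into `W`
that is defined on a subset of `V`. -/
inductive SumRel {V W : Type} {D : Set V} (g : D → W) : V ⊕ W → W → Prop
  | inl (v : D) : SumRel g (.inl v) (g v)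
  | inr (w : W) : SumRel g (.inr w) w

theorem SumRel.eq {V W : Type} {D : Set V} {g : D → W} {x : V ⊕ W} {w w' : W}
    (h : SumRel g x w) (h' : SumRel g x w') : w = w' := by
  generalize hy : x = y at h'
  cases h with
  | inl v =>
    cases h' with
    | inl v' => rw [Subtype.ext (Sum.inl.inj hy)]
    | inr => cases hy
  | inr =>
    cases h' with
    | inl v' => cases hy
    | inr => exact Sum.inr.inj hy

/-- The values `x` are related to values that form an `R`-fact of `J`. -/
def BlowUpArgs {S : Schema} {V W : Type} {D : Set V} (g : D → W) (J : DBInst S W) (R : S.Rel)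
    (x : Fin (S.arity R) → V ⊕ W) : Prop :=
  ∃ w : Fin (S.arity R) → W, (⟨R, w⟩ : DBFact S W) ∈ J ∧ ∀ i, SumRel g (x i) (w i)

/-- The instance over the three copies of `S` with values in `V ⊕ W` of the facts that are related
to facts of `J`. -/
def blowUp {S : Schema} {V W : Type} {D : Set V} (g : D → W) (J : DBInst S W) :
    DBInst (S.sum (S.sum S)) (V ⊕ W) :=
  {F | match F with
    | ⟨.inl R, x⟩ => BlowUpArgs g J R x
    | ⟨.inr (.inl R), x⟩ => BlowUpArgs g J R x
    | ⟨.inr (.inr R), x⟩ => BlowUpArgs g J R x}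

theorem DBInst.adom_image_aux {S : Schema} {V : Type} (I : DBInst S V) :
    DBInst.adom ((fun f : DBFact S V => (f.inl.inr : DBFact (S.sum (S.sum S)) V)) '' I) =
      I.adom := by
  ext v
  constructor
  · rintro ⟨_, ⟨f, hf, rfl⟩, i, rfl⟩
    exact ⟨f, hf, i, rfl⟩
  · rintro ⟨f, hf, i, rfl⟩
    exact ⟨_, ⟨f, hf, rfl⟩, i, rfl⟩

/-- An instance satisfies a rule with a single atom in the head and the same values in the body. -/
theorem TGD.holds_of_singleton {S : Schema} {V : Type} {r : TGD S} {J : DBInst S V}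
    {A B : DBFact S ℕ} (hA : r.body = {A}) (hB : r.head = {B}) (e : S.arity B.rel = S.arity A.rel)
    (he : ∀ i, B.args i = A.args (i.cast e))
    (hJ : ∀ x, (⟨A.rel, x⟩ : DBFact S V) ∈ J → (⟨B.rel, x ∘ Fin.cast e⟩ : DBFact S V) ∈ J) :
    r.Holds J := by
  intro ν
  have hAm : A ∈ r.body := hA ▸ rfl
  have hsub : r.head.adom ⊆ r.body.adom := by
    rintro _ ⟨f, hf, i, rfl⟩
    rw [hB] at hf
    obtain rfl := hf
    exact ⟨A, hAm, _, (he i).symm⟩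
  refine ⟨DBHom.ofFun (fun v => ν.toFun ⟨v, hsub v.2⟩) fun f hf => ?_, fun x hb hh => rfl⟩
  have hf' := hf
  rw [hB] at hf'
  obtain rfl := hf'
  convert hJ _ (ν.map_fact A hAm) using 1
  simp only [DBFact.image, DBFact.mk.injEq, heq_eq_eq, true_and]
  funext i
  exact congrArg (fun v => (ν.toFun v : V)) (Subtype.ext (he i))

/-- A match of a rule body projects to `J`, which supplies a match of the head. This lifts back by
keeping the given values of body variables and placing existential ones in the summand `W`. -/
theorem satisfies_blowUp {S : Schema} {T : Set (TGD S)} {V W : Type} {D : Set V} (g : D → W)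
    {J : DBInst S W} (hJ : Satisfies J T) : Satisfies (blowUp g J) (programOf T).rules := by
  rintro _ ((⟨r, hr, rfl⟩ | ⟨R, rfl⟩) | ⟨R, rfl⟩)
  · intro ν
    have hν : ∀ f (hf : f ∈ r.body), ∃ w : Fin (S.arity f.rel) → W,
        (⟨f.rel, w⟩ : DBFact S W) ∈ J ∧ ∀ i, SumRel g
          (ν.toFun ⟨f.args i, f.inl.inr, ⟨f, hf, rfl⟩, i, rfl⟩) (w i) :=
      fun f hf => ν.map_fact f.inl.inr ⟨f, hf, rfl⟩
    have hb : ∀ {x}, x ∈ r.body.adom → x ∈ r.toAux.body.adom := fun {x} hx => by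
      rw [← DBInst.adom_image_aux] at hx
      exact hx
    have hh : ∀ {x}, x ∈ r.toAux.head.adom → x ∈ r.head.adom := fun {x} hx => by
      rw [← DBInst.adom_image_aux]
      exact hx
    have hrel : ∀ x : r.body.adom, ∃ w, SumRel g (ν.toFun ⟨x, hb x.2⟩) w := by
      rintro ⟨_, f, hf, i, rfl⟩
      obtain ⟨w, -, hw⟩ := hν f hf
      exact ⟨w i, hw i⟩
    choose m hm using hrel
    obtain ⟨μ, hμ⟩ := hJ r hr (DBHom.ofFun m fun f hf => by
      obtain ⟨w, hwJ, hw⟩ := hν f hf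
      convert hwJ using 1
      simp only [DBFact.image, DBFact.mk.injEq, heq_eq_eq, true_and]
      funext i
      exact (hm _).eq (hw i))
    classical
    let u : r.toAux.head.adom → V ⊕ W := fun x =>
      if hx : (x : ℕ) ∈ r.body.adom then ν.toFun ⟨x, hb hx⟩ else .inr (μ.toFun ⟨x, hh x.2⟩)
    have hu : ∀ x, SumRel g (u x) (μ.toFun ⟨x, hh x.2⟩) := by
      intro x
      by_cases hx : (x : ℕ) ∈ r.body.adom
      · simp only [u, dif_pos hx]
        rw [hμ x hx (hh x.2)]
        exact hm ⟨x, hx⟩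
      · simp only [u, dif_neg hx]
        exact .inr _
    refine ⟨DBHom.ofFun u ?_, fun x hxb hxh => ?_⟩
    · rintro _ ⟨f, hf, rfl⟩
      exact ⟨_, μ.map_fact f hf, fun i => hu _⟩
    · have hx : x ∈ r.body.adom := by
        rw [← DBInst.adom_image_aux]
        exact hxb
      exact dif_pos hx
  · exact TGD.holds_of_singleton rfl rfl rfl (fun _ => rfl) fun x hx => hx
  · exact TGD.holds_of_singleton rfl rfl rfl (fun _ => rfl) fun x hx => hx

/-- A homomorphism from `I` to an instance that satisfies `Σ` extends to `P_Σ(I)`. -/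
theorem exists_hom_output {S : Schema} {T : Set (TGD S)} {V W : Type} {I : DBInst S V}
    {J : DBInst S W} (hJ : Satisfies J T) (g : DBHom I J) :
    ∃ h : DBHom ((programOf T).output I) J, ∀ (a : I.adom)
      (ha : ChaseVal.emb _ V a ∈ ((programOf T).output I).adom),
        (h.toFun ⟨_, ha⟩ : W) = g.toFun a := by
  let g' : I.adom → W := fun v => g.toFun v
  -- Solutions contain `I` through an injection, but `g` need not be injective. So universality is
  -- applied to the blow-up, where each `v` is a separate copy of `g v`, and the result is projected
  -- to `J`.
  obtain ⟨h, hh⟩ := ((programOf T).chase_isUniversalSolution I).2 (V ⊕ W)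
    ⟨Sum.inl, Sum.inl_injective⟩ (blowUp g' J)
    ⟨fun f hf => ⟨_, g.map_fact f hf, fun i => .inl ⟨f.args i, DBInst.args_mem_adom hf i⟩⟩,
      satisfies_blowUp g' hJ⟩
  have hsub : ∀ {x}, x ∈ ((programOf T).output I).adom → x ∈ ((programOf T).chase I).adom := by
    rintro _ ⟨f, hf, i, rfl⟩
    exact ⟨_, hf, i, rfl⟩
  have hout : ∀ f (hf : f ∈ (programOf T).output I), ∃ w : Fin (S.arity f.rel) → W,
      (⟨f.rel, w⟩ : DBFact S W) ∈ J ∧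
        ∀ i, SumRel g' (h.toFun ⟨f.args i, hsub (DBInst.args_mem_adom hf i)⟩) (w i) :=
    fun f hf => h.map_fact f.inr.inr hf
  have hrel : ∀ x : ((programOf T).output I).adom, ∃ w, SumRel g' (h.toFun ⟨x, hsub x.2⟩) w := by
    rintro ⟨_, f, hf, i, rfl⟩
    obtain ⟨w, -, hw⟩ := hout f hf
    exact ⟨w i, hw i⟩
  choose m hm using hrel
  refine ⟨DBHom.ofFun m fun f hf => ?_, fun a ha => ?_⟩
  · obtain ⟨w, hwJ, hw⟩ := hout f hf
    convert hwJ using 1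
    simp only [DBFact.image, DBFact.mk.injEq, heq_eq_eq, true_and]
    funext i
    exact (hm _).eq (hw i)
  · have h1 := hm ⟨_, ha⟩
    rw [hh a a.2 (hsub ha)] at h1
    exact h1.eq (.inl a)

/-- A rule that copies an atom with pairwise distinct variables. -/
theorem TGD.mem_of_holds_singleton {S : Schema} {V : Type} {r : TGD S} {J : DBInst S V}
    {A B : DBFact S ℕ} (hA : r.body = {A}) (hB : r.head = {B}) (e : S.arity B.rel = S.arity A.rel)
    (he : ∀ i, B.args i = A.args (i.cast e)) (hinj : Function.Injective A.args) (hr : r.Holds J)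
    {x : Fin (S.arity A.rel) → V} (hx : (⟨A.rel, x⟩ : DBFact S V) ∈ J) :
    (⟨B.rel, x ∘ Fin.cast e⟩ : DBFact S V) ∈ J := by
  have hidx : ∀ v : r.body.adom, ∃ i, A.args i = v := by
    rintro ⟨_, f, hf, i, rfl⟩
    rw [hA] at hf
    obtain rfl := hf
    exact ⟨i, rfl⟩
  choose idx hidx using hidx
  have hAm : A ∈ r.body := hA ▸ rfl
  have hBm : B ∈ r.head := hB ▸ rfl
  have hval : ∀ i, idx ⟨A.args i, DBInst.args_mem_adom hAm i⟩ = i := fun i => hinj (hidx _)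
  obtain ⟨μ, hμ⟩ := hr (DBHom.ofFun (fun v => x (idx v)) fun f hf => by
    have hf' := hf
    rw [hA] at hf'
    obtain rfl := hf'
    convert hx using 1
    simp only [DBFact.image, hval])
  convert μ.map_fact B hBm using 1
  simp only [DBFact.image, DBFact.mk.injEq, heq_eq_eq, true_and]
  funext i
  have hb : B.args i ∈ r.body.adom := ⟨A, hAm, _, (he i).symm⟩
  rw [hμ _ hb (DBInst.args_mem_adom hBm i)]
  change x _ = x (idx _)
  exact congrArg x (hinj ((he i).symm.trans (hidx ⟨_, hb⟩).symm))

/-- `P_Σ(I)` contains `I`. -/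
theorem map_emb_mem_output {S : Schema} (T : Set (TGD S)) {V : Type} {I : DBInst S V}
    {f : DBFact S V} (hf : f ∈ I) : f.map (ChaseVal.emb _ V) ∈ (programOf T).output I := by
  obtain ⟨h1, h2⟩ := (programOf T).chase_isSolution I
  have hinj : Function.Injective (S.genericAtom f.rel).args := Fin.val_injective
  have h3 := TGD.mem_of_holds_singleton (r := copyIn S f.rel) rfl rfl rfl (fun _ => rfl) hinj
    (h2 _ (Or.inl (Or.inr ⟨_, rfl⟩))) (h1 f hf)
  exact TGD.mem_of_holds_singleton (r := copyOut S f.rel) rfl rfl rfl (fun _ => rfl) hinj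
    (h2 _ (Or.inr ⟨_, rfl⟩)) h3

/-- The inclusion of `I` in `P_Σ(I)`. -/
def outputEmb {S : Schema} (T : Set (TGD S)) {V : Type} (I : DBInst S V) :
    DBHom I ((programOf T).output I) :=
  DBHom.ofFun (fun v => ChaseVal.emb _ V v) fun _ hf => map_emb_mem_output T hf

theorem UCQ.answers_hom {S : Schema} {k : ℕ} {V W : Type} {q : UCQ S k} {I : DBInst S V}
    {J : DBInst S W} (h : DBHom I J) {a : Fin k → I.adom}
    (ha : (fun i => (a i : V)) ∈ UCQ.answers q I) :
    (fun i => (h.toFun (a i) : W)) ∈ UCQ.answers q J := by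
  obtain ⟨c, hc, ν, hν⟩ := ha
  exact ⟨c, hc, h.comp ν, fun i =>
    congrArg (fun v => (h.toFun v : W)) (Subtype.ext (hν i))⟩

/-! ### The characterizing examples -/

/-- The canonical instance of a conjunctive query. -/
def CQ.canonical {S : Schema} {k : ℕ} (c : CQ S k) : PointedFinInst S k :=
  ⟨⟨ℕ, c.body, c.body_finite⟩, c.free⟩

theorem mainTheorem12 (S : Schema) (T : Set (TGD S)) (hfin : T.Finite)
    (hadj : (programOf T).HasGeneralizedRightAdjoint) (hctrl : FinitelyControllable T)
    (k : ℕ) (q : UCQ S k) (hq : UCQ.IsCAcyclic q) :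
    ∃ Epos Eneg : Set (PointedFinInst S k),
      Epos.Finite ∧ Eneg.Finite ∧ UniquelyCharacterizes T Epos Eneg q := by
  obtain ⟨Ω, hΩ⟩ := hadj
  obtain ⟨Δ, hΔfin, hΔ⟩ := UCQ.exists_isDual q hq
  have hemb : ∀ {V : Type} {I : DBInst S V} (a : I.adom),
      ChaseVal.emb _ V (a : V) ∈ ((programOf T).output I).adom :=
    fun {V I} a => ((outputEmb T I).toFun a).2
  let E : Set (PointedFinInst S k) := ⋃ X ∈ Δ, ⋃ p ∈ Ω X.toFinInst,
    (fun b => ⟨p.1, b⟩) '' {b : Fin k → p.1.facts.adom |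
      ∀ i, ∃ y, p.2 (b i) = some y ∧ (y : X.Dom) = X.pt i}
  have hE : ∀ A, A ∈ E ↔ ∃ X ∈ Δ, ∃ p ∈ Ω X.toFinInst, ∃ b : Fin k → p.1.facts.adom,
      (∀ i, ∃ y, p.2 (b i) = some y ∧ (y : X.Dom) = X.pt i) ∧ (⟨p.1, b⟩ : PointedFinInst S k) = A := by
    intro A
    simp only [E, Set.mem_iUnion, exists_prop, Set.mem_image, Set.mem_ofPred_eq]
  refine ⟨CQ.canonical '' {c | c ∈ q}, E, (List.finite_toSet q).image _, ?_, ⟨?_, ?_⟩, ?_⟩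
  · refine hΔfin.biUnion fun X _ => (hΩ X.toFinInst).1.biUnion fun p _ => ?_
    have := (DBInst.finite_adom p.1.finite).to_subtype
    exact (Set.toFinite _).image _
  · rintro _ ⟨c, hc, rfl⟩
    exact ⟨c, hc, outputEmb T c.body, fun i => rfl⟩
  · intro A hA hold
    obtain ⟨X, hX, p, hp, b, hb, rfl⟩ := (hE A).1 hA
    -- The identity of `J'` transposes to `P_Σ(J') → X` taking the point to the point of `X`, where
    -- `q` fails by duality.
    obtain ⟨h, hh⟩ := ((hΩ X.toFinInst).2 _ p.1.facts).2 p hp (DBHom.id _)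
    have hpt : ∀ i, (h.toFun ⟨_, hemb (b i)⟩ : X.Dom) = X.pt i := by
      intro i
      obtain ⟨y, hy, hyX⟩ := hb i
      rw [← hyX, ← Option.some.inj (hy.symm.trans (hh (b i) (hemb _)))]
    have hans := UCQ.answers_hom (a := fun i => ⟨_, hemb (b i)⟩) h hold
    exact (hΔ X.facts _).2 ⟨X, hX, DBHom.id _, hpt⟩ hans
  · intro q' hq'
    have hequiv : UCQ.EquivWrt T q' q := by
      intro V I hI
      ext a
      constructor
      · rintro ⟨c, hc, ν, hν⟩
        by_contra hna
        obtain rfl : (fun i => (ν.toFun (c.free i) : V)) = a := funext hν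
        obtain ⟨X, hX, g, hg⟩ := (hΔ I _).1 hna
        -- As `I` satisfies `Σ`, its output maps back to `I`, identically on `adom I`; so `g`
        -- becomes a map `P_Σ(I) → X` that can be transposed.
        obtain ⟨e, he⟩ := exists_hom_output hI (DBHom.id I)
        obtain ⟨p, hp, h', hh'⟩ := ((hΩ X.toFinInst).2 V I).1 (g.comp e)
        have hmem := (hE _).2 ⟨X, hX, p, hp, fun i => h'.toFun (ν.toFun (c.free i)), fun i =>
          ⟨_, hh' _ (hemb _), by
            rw [← hg i]
            exact congrArg (fun v => (g.toFun v : X.Dom)) (Subtype.ext (he _ (hemb _)))⟩, rfl⟩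
        exact hq'.2 _ hmem ⟨c, hc, (outputEmb T _).comp (h'.comp ν), fun i => rfl⟩
      · rintro ⟨c, hc, ν, hν⟩
        obtain rfl : (fun i => (ν.toFun (c.free i) : V)) = a := funext hν
        have hold := hq'.1 _ ⟨c, hc, rfl⟩
        obtain ⟨h, hh⟩ := exists_hom_output hI ν
        have hans := UCQ.answers_hom (a := fun i => ⟨_, hemb (c.free i)⟩) h hold
        have : (fun i => (h.toFun ⟨_, hemb (c.free i)⟩ : V)) =
            fun i => (ν.toFun (c.free i) : V) := funext fun i => hh _ _
        rwa [this] at hans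
    exact ⟨fun V I _ hI => hequiv V I hI, hequiv⟩
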